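/- **Theorem (BSC: meta-converse vs. normal approximation).** Fix a crossover probability $P_{\rm bit}\in(0,\tfrac12)$ and an error probability $P_e\in(0,1)$. For $n\ge1$ and $\mathbf a,\mathbf b\in\{\pm1\}^n$ at Hamming distance $\|\mathbf b-\mathbf a\|_H$, let $$p_{y|x}(\mathbf b|\mathbf a)=(1-P_{\rm bit})^n\Big(\tfrac{P_{\rm bit}}{1-P_{\rm bit}}\Big)^{\|\mathbf b-\mathbf a\|_H},\qquad p_y(\mathbf b)=2^{-n},\qquad \Lambda(\mathbf a,\mathbf b)=\frac1n\ln\frac{p_{y|x}(\mathbf b|\mathbf a)}{p_y(\mathbf b)} .$$ Let $P_{y|\mathbf a}$ and $P_y$ denote probability for $\mathbf y\sim p_{y|x}(\cdot|\mathbf a)$ and $\mathbf y\sim p_y$, respectively. The Polyanskiy–Poor–Verdú (PPV) meta-converse bound on the rate is $$\overline R=\overline R(n)=-\frac1n\log_2\Big(P_y[\Lambda(\mathbf a,\mathbf y)\ge t]-\zeta\,P_y[\Lambda(\mathbf a,\mathbf y)=t]\Big),$$ where the threshold $t\in\mathbb R$ and the randomization $0\le\zeta<1$ are set by $$P_e=P_{y|\mathbf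 a}[\Lambda(\mathbf a,\mathbf y)<t]+\zeta\,P_{y|\mathbf a}[\Lambda(\mathbf a,\mathbf y)=t].$$ Such $t,\zeta$ exist, and the value $\overline R$ depends neither on their choice nor on $\mathbf a$. In terms of $q_n(k;\epsilon)=\binom nk(1-\epsilon)^{n-k}\epsilon^k$ one has $$\overline R=-\frac1n\log_2\Big(\sum_{k=0}^{d}q_n(k;\tfrac12)-\zeta\,q_n(d;\tfrac12)\Big),$$ where $d\in\{0,\dots,n\}$ is the smallest nonnegative integer with $\sum_{k=d+1}^{n}q_n(k;P_{\rm bit})\le P_e$, and $\zeta\in[0,1)$ is defined by $P_e=\sum_{k=d+1}^{n}q_n(k;P_{\rm bit})+\zeta\,q_n(d;P_{\rm bit})$. Then, as $n\to\infty$ with $P_{\rm bit}$ and $P_e$ fixed, $$\overline R=R_{\rm NA}+O(1/n),\qquad R_{\rm NA}=C-\sqrt{\frac Vn}\,\log_2(e)\,Q^{-1}(P_e)+\frac{\log_2 n}{2n},$$ where $C=1+P_{\rm bit}\log_2P_{\rm bit}+(1-P_{\rm bit})\log_2(1-P_{\rm bit})$ is the capacity, $Q$ is the complementary distribution function of the standard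 Gaussian, and $$V=P_{\rm bit}(1-P_{\rm bit})\,\ln^2\Big(\frac{1-P_{\rm bit}}{P_{\rm bit}}\Big)$$ is the channel dispersion. -/

import Mathlib

open MeasureTheory ProbabilityTheory Filter Asymptotics

noncomputable section

namespace BSC

/-- Channel input and output words of length `n` over the alphabet `{1, -1}`. -/
abbrev Word (n : ℕ) : Type := Fin n → ℤˣ

/-- Transition probability `p_{y|x}(b | a)` of the binary symmetric channel with crossover
probability `p`, used `n` times. -/
def trans (p : ℝ) {n : ℕ} (a b : Word n) : ℝ :=
  (1 - p) ^ n * (p / (1 - p)) ^ hammingDist b a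

/-- The capacity achieving output distribution `p_y(b) = 2 ^ (-n)`. -/
def outDist {n : ℕ} (_b : Word n) : ℝ := (1 / 2 : ℝ) ^ n

/-- The normalized log-likelihood `Λ(a, b) = (1 / n) ln (p_{y|x}(b | a) / p_y(b))`. -/
def llr (p : ℝ) {n : ℕ} (a b : Word n) : ℝ :=
  1 / (n : ℝ) * Real.log (trans p a b / outDist b)

open Classical in
/-- False alarm probability `P[Λ(a, y) ≥ t]`, with `y ∼ p_y`. -/
def probFA (p : ℝ) {n : ℕ} (a : Word n) (t : ℝ) : ℝ :=
  ∑ b : Word n with llr p a b ≥ t, outDist b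

open Classical in
/-- Missed detection probability `P[Λ(a, y) < t]`, with `y ∼ p_{y|x}(· | a)`. -/
def probMD (p : ℝ) {n : ℕ} (a : Word n) (t : ℝ) : ℝ :=
  ∑ b : Word n with llr p a b < t, trans p a b

open Classical in
/-- Probability `P[Λ(a, y) = t]` on the threshold, with `y ∼ p_y`. -/
def atomFA (p : ℝ) {n : ℕ} (a : Word n) (t : ℝ) : ℝ :=
  ∑ b : Word n with llr p a b = t, outDist b

open Classical in
/-- Probability `P[Λ(a, y) = t]` on the threshold, with `y ∼ p_{y|x}(· | a)`. -/
def atomMD (p : ℝ) {n : ℕ} (a : Word n) (t : ℝ) : ℝ :=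
  ∑ b : Word n with llr p a b = t, trans p a b

/-- `R` is the value of the PPV meta-converse bound, at the codeword `a` and at error probability
`Pe`: the randomized Neyman-Pearson test accepts `a` if `Λ > t`, rejects it if `Λ < t`, and rejects
it with probability `ζ` if `Λ = t`, where `t` and `ζ` are such that the missed detection probability
is `Pe`; then `R` is `-(1 / n) log₂` of the false alarm probability of the test. -/
def IsMetaConverse (p Pe : ℝ) {n : ℕ} (a : Word n) (R : ℝ) : Prop :=
  ∃ t ζ : ℝ, 0 ≤ ζ ∧ ζ < 1 ∧ Pe = probMD p a t + ζ * atomMD p a t ∧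
    R = -(1 / (n : ℝ)) * Real.logb 2 (probFA p a t - ζ * atomFA p a t)

/-- The binomial probability `q_n(d; ε)`. -/
def binom (n d : ℕ) (ε : ℝ) : ℝ := (n.choose d : ℝ) * (1 - ε) ^ (n - d) * ε ^ d

/-- The binomial distribution function of parameters `n` and `1 / 2` at `d`. -/
def binomFA (n d : ℕ) : ℝ := ∑ k ∈ Finset.Icc 0 d, binom n k (1 / 2)

/-- The complementary binomial distribution function of parameters `n` and `p` at `d`. -/
def binomMD (p : ℝ) (n d : ℕ) : ℝ := ∑ k ∈ Finset.Ioc d n, binom n k p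

/-- The Gaussian complementary distribution function. -/
def gaussQ (x : ℝ) : ℝ := (gaussianReal 0 1).real (Set.Ioi x)

/-- The inverse of `gaussQ`, which is a bijection of `ℝ` onto the interval `(0, 1)`;
meaningful only on that interval. -/
def gaussQInv (ε : ℝ) : ℝ := Function.invFun gaussQ ε

/-- The binary entropy function, in bits. -/
def entropy (x : ℝ) : ℝ := -x * Real.logb 2 x - (1 - x) * Real.logb 2 (1 - x)

/-- The capacity, in bits per channel use. -/
def capacity (p : ℝ) : ℝ := 1 - entropy p

/-- The channel dispersion. -/
def dispersion (p : ℝ) : ℝ := p * (1 - p) * Real.log ((1 - p) / p) ^ 2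

/-- The normal approximation with capacity `C` and dispersion `V`. -/
def normalApprox (C V Pe : ℝ) (n : ℕ) : ℝ :=
  C - √(V / n) * Real.logb 2 (Real.exp 1) * gaussQInv Pe + Real.logb 2 n / (2 * n)

end BSC

end

/-!
The randomized Neyman-Pearson test depends on the output word only through its Hamming distance to
the codeword, so the meta-converse bound is a statement about the two binomial distributions of
parameters `p` and `1 / 2`.

The Stein identity of the binomial distribution, applied to the solution of the Gaussian Stein
equation for a half-line, gives `P[X ≥ m] = Q((m - n p) / σ) + O(1 / σ)` with `σ = √(n p (1 - p))`.
As `Q` is decreasing with nonzero derivative, the threshold satisfies `d = n p + σ Q⁻¹(Pe) + O(1)`.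
At such a `d`, Stirling's formula gives `log q_n(d; p) = - log n / 2 + O(1)`, and
`log q_n(d; 1 / 2)` differs from `log q_n(d; p)` by an explicit affine function of `d`. Since
`p < 1 / 2`, the terms `q_n(k; 1 / 2)` with `k ≤ d` grow at least geometrically in `k`, so the
false alarm probability is `q_n(d; 1 / 2)` up to a bounded factor; it remains to take logarithms.
-/

noncomputable section

namespace BSC

section NeymanPearson

/-- The randomized likelihood ratio test with threshold `t` and randomization `ζ`, as the
probability of rejecting at the likelihood ratio `ℓ`. -/
def thresholdTest {β : Type*} [LinearOrder β] (t : β) (ζ : ℝ) (ℓ : β) : ℝ :=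
  if ℓ < t then 1 else if ℓ = t then ζ else 0

theorem thresholdTest_le_of_lt {β : Type*} [LinearOrder β] {t₁ t₂ : β} {ζ₁ ζ₂ : ℝ} (ht : t₁ < t₂)
    (h₁ : ζ₁ ≤ 1) (h₂ : 0 ≤ ζ₂) : thresholdTest t₁ ζ₁ ≤ thresholdTest t₂ ζ₂ := by
  intro ℓ
  unfold thresholdTest
  split_ifs <;> first | (exfalso; order) | linarith

theorem thresholdTest_mono {β : Type*} [LinearOrder β] (t : β) : Monotone (thresholdTest t) := by
  intro ζ₁ ζ₂ h ℓ
  unfold thresholdTest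
  split_ifs <;> simp [h]

theorem thresholdTest_le_total {β : Type*} [LinearOrder β] {t₁ t₂ : β} {ζ₁ ζ₂ : ℝ}
    (h₁ : ζ₁ ∈ Set.Icc 0 1) (h₂ : ζ₂ ∈ Set.Icc 0 1) :
    thresholdTest t₁ ζ₁ ≤ thresholdTest t₂ ζ₂ ∨ thresholdTest t₂ ζ₂ ≤ thresholdTest t₁ ζ₁ := by
  rcases lt_trichotomy t₁ t₂ with ht | rfl | ht
  · exact .inl (thresholdTest_le_of_lt ht h₁.2 h₂.1)
  · exact (le_total ζ₁ ζ₂).imp (thresholdTest_mono t₁ ·) (thresholdTest_mono t₁ ·)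
  · exact .inr (thresholdTest_le_of_lt ht h₂.2 h₁.1)

theorem eq_of_le_of_sum_mul_eq {ι : Type*} [Fintype ι] {f g w : ι → ℝ} (hw : ∀ i, 0 < w i)
    (hle : f ≤ g) (h : ∑ i, f i * w i = ∑ i, g i * w i) : f = g := by
  have hmul := (Finset.sum_eq_sum_iff_of_le
    fun i _ => mul_le_mul_of_nonneg_right (hle i) (hw i).le).1 h
  funext i
  exact mul_right_cancel₀ (hw i).ne' (hmul i (Finset.mem_univ i))

variable {p : ℝ} {n : ℕ}

theorem probMD_add_mul_atomMD (a : Word n) (t ζ : ℝ) :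
    probMD p a t + ζ * atomMD p a t = ∑ b, thresholdTest t ζ (llr p a b) * trans p a b := by
  simp only [probMD, atomMD, thresholdTest, Finset.sum_filter, Finset.mul_sum,
    ← Finset.sum_add_distrib]
  refine Finset.sum_congr rfl fun b _ => ?_
  split_ifs <;> first | (exfalso; order) | ring

theorem probFA_sub_mul_atomFA (a : Word n) (t ζ : ℝ) :
    probFA p a t - ζ * atomFA p a t =
      ∑ b, (1 - thresholdTest t ζ (llr p a b)) * outDist b := by
  simp only [probFA, atomFA, thresholdTest, Finset.sum_filter, Finset.mul_sum,
    ← Finset.sum_sub_distrib]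
  refine Finset.sum_congr rfl fun b _ => ?_
  split_ifs <;> first | (exfalso; order) | ring

theorem trans_pos (hp0 : 0 < p) (hp1 : p < 1) (a b : Word n) : 0 < trans p a b := by
  have : 0 < 1 - p := sub_pos.2 hp1
  unfold trans
  positivity

theorem IsMetaConverse.unique (hp0 : 0 < p) (hp1 : p < 1) {Pe : ℝ} {a : Word n} {R₁ R₂ : ℝ}
    (h₁ : IsMetaConverse p Pe a R₁) (h₂ : IsMetaConverse p Pe a R₂) : R₁ = R₂ := by
  obtain ⟨t₁, ζ₁, h₁0, h₁1, hPe₁, rfl⟩ := h₁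
  obtain ⟨t₂, ζ₂, h₂0, h₂1, hPe₂, rfl⟩ := h₂
  rw [probMD_add_mul_atomMD] at hPe₁ hPe₂
  have hpos := trans_pos hp0 hp1 a
  have heq : (fun b => thresholdTest t₁ ζ₁ (llr p a b)) =
      fun b => thresholdTest t₂ ζ₂ (llr p a b) := by
    rcases thresholdTest_le_total (t₁ := t₁) (t₂ := t₂) ⟨h₁0, h₁1.le⟩ ⟨h₂0, h₂1.le⟩ with hle | hle
    · exact eq_of_le_of_sum_mul_eq hpos (fun b => hle _) (hPe₁.symm.trans hPe₂)
    · exact (eq_of_le_of_sum_mul_eq hpos (fun b => hle _) (hPe₂.symm.trans hPe₁)).symm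
  simp only [probFA_sub_mul_atomFA, funext_iff.1 heq]

end NeymanPearson

section Binomial

variable {p : ℝ} {n : ℕ}

/-- A word is encoded by the set of positions in which it differs from a given word. -/
def wordEquivFinset (a : Word n) : Word n ≃ Finset (Fin n) where
  toFun b := {i | b i ≠ a i}
  invFun s i := if i ∈ s then -a i else a i
  left_inv b := by
    funext i
    by_cases h : b i = a i
    · simp [h]
    · simp [Int.units_ne_iff_eq_neg.1 h]
  right_inv s := by
    ext i
    by_cases h : i ∈ s <;> simp [h]

theorem sum_hammingDist (a : Word n) (g : ℕ → ℝ) :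
    ∑ b : Word n, g (hammingDist b a) = ∑ k ∈ Finset.range (n + 1), (n.choose k : ℝ) * g k := calc
  ∑ b : Word n, g (hammingDist b a) = ∑ s : Finset (Fin n), g s.card :=
    Fintype.sum_equiv (wordEquivFinset a) _ _ fun _ => rfl
  _ = ∑ k ∈ Finset.range (n + 1), (n.choose k : ℝ) * g k := by
    simpa using Finset.sum_powerset_apply_card g (x := (Finset.univ : Finset (Fin n)))

theorem choose_mul_trans_eq_binom (hp1 : p < 1) {k : ℕ} (hk : k ≤ n) :
    (n.choose k : ℝ) * ((1 - p) ^ n * (p / (1 - p)) ^ k) = binom n k p := by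
  have hq : 1 - p ≠ 0 := (sub_pos.2 hp1).ne'
  rw [binom, div_pow, mul_assoc, ← pow_sub_mul_pow (1 - p) hk]
  field_simp

theorem sum_trans_filter (hp1 : p < 1) (a : Word n) {P : Word n → Prop} {P' : ℕ → Prop}
    [DecidablePred P] [DecidablePred P'] (h : ∀ b, P b ↔ P' (hammingDist b a)) :
    ∑ b with P b, trans p a b = ∑ k ∈ Finset.range (n + 1) with P' k, binom n k p := by
  simp only [Finset.sum_filter, h, trans]
  rw [sum_hammingDist a fun k => if P' k then (1 - p) ^ n * (p / (1 - p)) ^ k else 0]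
  refine Finset.sum_congr rfl fun k hk => ?_
  rw [mul_ite, mul_zero, choose_mul_trans_eq_binom hp1 (Finset.mem_range_succ_iff.1 hk)]

theorem trans_half (a b : Word n) : trans (1 / 2) a b = outDist b := by
  norm_num [trans, outDist]

/-- The value of the normalized log-likelihood `llr` at Hamming distance `k`. -/
def llrAt (p : ℝ) (n k : ℕ) : ℝ :=
  1 / (n : ℝ) * Real.log ((1 - p) ^ n * (p / (1 - p)) ^ k / (1 / 2 : ℝ) ^ n)

theorem llrAt_strictAnti (hp0 : 0 < p) (hp1 : p < 1 / 2) (hn : n ≠ 0) :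
    StrictAnti (llrAt p n) := by
  have hq : 0 < 1 - p := by linarith
  have hr : p / (1 - p) < 1 := by rw [div_lt_one hq]; linarith
  intro j k hjk
  have : (0 : ℝ) < n := by positivity
  have hpow := pow_lt_pow_right_of_lt_one₀ (div_pos hp0 hq) hr hjk
  unfold llrAt
  gcongr

section threshold

variable (hp0 : 0 < p) (hp1 : p < 1 / 2) (hn : n ≠ 0) (a : Word n)

include hp0 hp1 hn

theorem llr_lt_llrAt_iff {b : Word n} {d : ℕ} :
    llr p a b < llrAt p n d ↔ d < hammingDist b a :=
  (llrAt_strictAnti hp0 hp1 hn).lt_iff_gt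

theorem llr_eq_llrAt_iff {b : Word n} {d : ℕ} :
    llr p a b = llrAt p n d ↔ hammingDist b a = d :=
  (llrAt_strictAnti hp0 hp1 hn).injective.eq_iff

theorem llrAt_le_llr_iff {b : Word n} {d : ℕ} :
    llrAt p n d ≤ llr p a b ↔ hammingDist b a ≤ d :=
  (llrAt_strictAnti hp0 hp1 hn).le_iff_ge

theorem probMD_llrAt (d : ℕ) : probMD p a (llrAt p n d) = binomMD p n d := by
  rw [probMD, sum_trans_filter (by linarith) a (P' := (d < ·))
    fun _ => llr_lt_llrAt_iff hp0 hp1 hn a]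
  congr 1
  grind

theorem atomMD_llrAt {d : ℕ} (hd : d ≤ n) : atomMD p a (llrAt p n d) = binom n d p := by
  rw [atomMD, sum_trans_filter (by linarith) a (P' := (· = d))
    fun _ => llr_eq_llrAt_iff hp0 hp1 hn a]
  simp [Finset.filter_eq', Nat.lt_succ_of_le hd]

theorem probFA_llrAt {d : ℕ} (hd : d ≤ n) : probFA p a (llrAt p n d) = binomFA n d := by
  simp only [probFA, ← trans_half a]
  rw [sum_trans_filter (by norm_num) a (P' := (· ≤ d))
    fun _ => llrAt_le_llr_iff hp0 hp1 hn a]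
  congr 1
  grind

theorem atomFA_llrAt {d : ℕ} (hd : d ≤ n) : atomFA p a (llrAt p n d) = binom n d (1 / 2) := by
  simp only [atomFA, ← trans_half a]
  rw [sum_trans_filter (by norm_num) a (P' := (· = d))
    fun _ => llr_eq_llrAt_iff hp0 hp1 hn a]
  simp [Finset.filter_eq', Nat.lt_succ_of_le hd]

theorem isMetaConverse_of_binom {Pe ζ : ℝ} {d : ℕ} (hd : d ≤ n) (hζ0 : 0 ≤ ζ) (hζ1 : ζ < 1)
    (hPe : Pe = binomMD p n d + ζ * binom n d p) :
    IsMetaConverse p Pe a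
      (-(1 / (n : ℝ)) * Real.logb 2 (binomFA n d - ζ * binom n d (1 / 2))) := by
  refine ⟨llrAt p n d, ζ, hζ0, hζ1, ?_, ?_⟩
  · rw [hPe, probMD_llrAt hp0 hp1 hn, atomMD_llrAt hp0 hp1 hn a hd]
  · rw [probFA_llrAt hp0 hp1 hn a hd, atomFA_llrAt hp0 hp1 hn a hd]

end threshold

theorem binom_eq_eval_bernsteinPolynomial (n k : ℕ) (p : ℝ) :
    binom n k p = (bernsteinPolynomial ℝ n k).eval p := by
  simp only [binom, bernsteinPolynomial, Polynomial.eval_mul, Polynomial.eval_natCast,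
    Polynomial.eval_pow, Polynomial.eval_X, Polynomial.eval_sub, Polynomial.eval_one]
  ring

theorem sum_binom (p : ℝ) (n : ℕ) : ∑ k ∈ Finset.range (n + 1), binom n k p = 1 := by
  simpa [Polynomial.eval_finsetSum, binom_eq_eval_bernsteinPolynomial] using
    congrArg (Polynomial.eval p) (bernsteinPolynomial.sum ℝ n)

theorem sum_binom_variance (p : ℝ) (n : ℕ) :
    ∑ k ∈ Finset.range (n + 1), binom n k p * (k - n * p) ^ 2 = n * (p * (1 - p)) := by
  have h := congrArg (Polynomial.eval p) (bernsteinPolynomial.variance ℝ n)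
  simp only [Polynomial.eval_finsetSum, ← binom_eq_eval_bernsteinPolynomial, nsmul_eq_mul,
    Polynomial.eval_mul, Polynomial.eval_pow, Polynomial.eval_sub, Polynomial.eval_natCast,
    Polynomial.eval_X, Polynomial.eval_one] at h
  rw [← mul_assoc, ← h]
  exact Finset.sum_congr rfl fun k _ => by ring

theorem binom_nonneg (hp0 : 0 ≤ p) (hp1 : p ≤ 1) (n k : ℕ) : 0 ≤ binom n k p := by
  have : 0 ≤ 1 - p := sub_nonneg.2 hp1
  unfold binom
  positivity

theorem binom_pos (hp0 : 0 < p) (hp1 : p < 1) {k : ℕ} (hk : k ≤ n) : 0 < binom n k p := by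
  have : 0 < 1 - p := sub_pos.2 hp1
  have hc : 0 < n.choose k := Nat.choose_pos hk
  unfold binom
  positivity

/-- The upper tail `P[X ≥ m]` of the binomial distribution of parameters `n` and `p`; unlike
`binomMD`, it includes the endpoint. -/
def binomTail (p : ℝ) (n m : ℕ) : ℝ := ∑ k ∈ Finset.Icc m n, binom n k p

theorem binomTail_succ (p : ℝ) (n d : ℕ) : binomTail p n (d + 1) = binomMD p n d := by
  rw [binomTail, binomMD]
  congr 1
  grind

theorem binomTail_eq_binomMD_add {d : ℕ} (hd : d ≤ n) :
    binomTail p n d = binomMD p n d + binom n d p := by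
  rw [binomTail, ← Finset.Ioc_insert_left hd, Finset.sum_insert (by simp), add_comm]
  rfl

theorem binomTail_zero (p : ℝ) (n : ℕ) : binomTail p n 0 = 1 := by
  rw [← sum_binom p n, binomTail, Finset.range_eq_Ico]
  congr 1

theorem lt_binomTail_of_isLeast {Pe : ℝ} (hPe1 : Pe < 1) {d : ℕ}
    (hd : IsLeast {k | binomMD p n k ≤ Pe} d) : Pe < binomTail p n d := by
  cases d with
  | zero => rwa [binomTail_zero]
  | succ e =>
    rw [binomTail_succ]
    exact lt_of_not_ge fun he => (hd.2 he).not_gt e.lt_succ_self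

theorem exists_threshold (hp0 : 0 < p) (hp1 : p < 1) {Pe : ℝ} (hPe0 : 0 ≤ Pe) (hPe1 : Pe < 1)
    (n : ℕ) : ∃ (d : ℕ) (ζ : ℝ),
      IsLeast {k : ℕ | binomMD p n k ≤ Pe} d ∧ d ≤ n ∧ 0 ≤ ζ ∧ ζ < 1 ∧
        Pe = binomMD p n d + ζ * binom n d p := by
  classical
  have hn : binomMD p n n ≤ Pe := by simpa [binomMD] using hPe0
  obtain ⟨d, hd⟩ : ∃ d, IsLeast {k : ℕ | binomMD p n k ≤ Pe} d :=
    ⟨_, Nat.isLeast_find ⟨n, hn⟩⟩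
  have hdn : d ≤ n := hd.2 hn
  have hpos := binom_pos hp0 hp1 hdn
  have hlt := lt_binomTail_of_isLeast hPe1 hd
  rw [binomTail_eq_binomMD_add hdn] at hlt
  refine ⟨d, (Pe - binomMD p n d) / binom n d p, hd, hdn, div_nonneg (sub_nonneg.2 hd.1) hpos.le,
    ?_, ?_⟩
  · rw [div_lt_one hpos]; linarith
  · rw [div_mul_cancel₀ _ hpos.ne']; ring

end Binomial

section Gaussian

theorem continuous_gaussianPDFReal : Continuous (gaussianPDFReal 0 1) := by
  rw [gaussianPDFReal_def]
  fun_prop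

theorem gaussianPDFReal_zero_one (w : ℝ) :
    gaussianPDFReal 0 1 w = (√(2 * Real.pi))⁻¹ * Real.exp (-(w ^ 2 / 2)) := by
  simp [gaussianPDFReal, neg_div]

theorem gaussianPDFReal_le_one (w : ℝ) : gaussianPDFReal 0 1 w ≤ 1 := by
  rw [gaussianPDFReal_zero_one]
  have hsqrt : 1 ≤ √(2 * Real.pi) := Real.one_le_sqrt.2 (by linarith [Real.pi_gt_three])
  exact mul_le_one₀ (inv_le_one_of_one_le₀ hsqrt) (Real.exp_pos _).le
    (Real.exp_le_one_iff.2 (by linarith [sq_nonneg w]))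

theorem gaussianPDFReal_neg (w : ℝ) : gaussianPDFReal 0 1 (-w) = gaussianPDFReal 0 1 w := by
  simp [gaussianPDFReal_zero_one]

theorem hasDerivAt_gaussianPDFReal (w : ℝ) :
    HasDerivAt (gaussianPDFReal 0 1) (-(w * gaussianPDFReal 0 1 w)) w := by
  rw [funext gaussianPDFReal_zero_one]
  have hexp : HasDerivAt (fun u : ℝ => -(u ^ 2 / 2)) (-w) w := by
    simpa using ((hasDerivAt_pow 2 w).div_const 2).fun_neg
  convert! hexp.exp.const_mul (√(2 * Real.pi))⁻¹ using 1
  ring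

theorem tendsto_gaussianPDFReal_atTop : Tendsto (gaussianPDFReal 0 1) atTop (nhds 0) := by
  rw [funext gaussianPDFReal_zero_one]
  have hsq : Tendsto (fun u : ℝ => u ^ 2 / 2) atTop atTop :=
    (tendsto_pow_atTop two_ne_zero).atTop_div_const two_pos
  simpa using (Real.tendsto_exp_neg_atTop_nhds_zero.comp hsq).const_mul (√(2 * Real.pi))⁻¹

theorem gaussQ_eq_integral (x : ℝ) : gaussQ x = ∫ u in Set.Ioi x, gaussianPDFReal 0 1 u := by
  rw [gaussQ, measureReal_def, gaussianReal_apply_eq_integral 0 one_ne_zero,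
    ENNReal.toReal_ofReal (integral_nonneg fun u => gaussianPDFReal_nonneg 0 1 u)]

theorem gaussQ_eq_one_sub_cdf (x : ℝ) : gaussQ x = 1 - cdf (gaussianReal 0 1) x := by
  rw [gaussQ, cdf_eq_real, ← Set.compl_Iic, probReal_compl_eq_one_sub measurableSet_Iic]

theorem gaussQ_nonneg (x : ℝ) : 0 ≤ gaussQ x := measureReal_nonneg

theorem gaussQ_le_one (x : ℝ) : gaussQ x ≤ 1 := measureReal_le_one

theorem gaussQ_neg (x : ℝ) : gaussQ (-x) = 1 - gaussQ x := by
  have hint := integrable_gaussianPDFReal 0 1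
  have hIic : gaussQ (-x) = ∫ u in Set.Iic x, gaussianPDFReal 0 1 u := by
    rw [gaussQ_eq_integral, ← integral_comp_neg_Iic]
    simp only [gaussianPDFReal_neg]
  rw [hIic, gaussQ_eq_integral, eq_sub_iff_add_eq,
    intervalIntegral.integral_Iic_add_Ioi hint.integrableOn hint.integrableOn,
    integral_gaussianPDFReal_eq_one 0 one_ne_zero]

theorem hasDerivAt_gaussQ (x : ℝ) : HasDerivAt gaussQ (-gaussianPDFReal 0 1 x) x := by
  have hint := integrable_gaussianPDFReal 0 1
  have heq : gaussQ = fun y => gaussQ 0 - ∫ u in (0 : ℝ)..y, gaussianPDFReal 0 1 u := by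
    funext y
    rw [gaussQ_eq_integral, gaussQ_eq_integral,
      ← intervalIntegral.integral_Ioi_sub_Ioi' hint.integrableOn hint.integrableOn, sub_sub_cancel]
  rw [heq]
  exact (continuous_gaussianPDFReal.integral_hasStrictDerivAt 0 x).hasDerivAt.const_sub _

theorem gaussQ_strictAnti : StrictAnti gaussQ :=
  strictAnti_of_hasDerivAt_neg hasDerivAt_gaussQ fun x =>
    neg_neg_of_pos (gaussianPDFReal_pos 0 1 x one_ne_zero)

theorem lipschitzWith_gaussQ : LipschitzWith 1 gaussQ :=
  lipschitzWith_of_nnnorm_deriv_le (fun x => (hasDerivAt_gaussQ x).differentiableAt) fun x => by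
    rw [(hasDerivAt_gaussQ x).deriv, nnnorm_neg, ← NNReal.coe_le_coe, coe_nnnorm,
      Real.norm_of_nonneg (gaussianPDFReal_nonneg 0 1 x)]
    exact gaussianPDFReal_le_one x

theorem gaussQ_gaussQInv {ε : ℝ} (h0 : 0 < ε) (h1 : ε < 1) : gaussQ (gaussQInv ε) = ε := by
  have htop : Tendsto gaussQ atTop (nhds 0) := by
    simpa only [← gaussQ_eq_one_sub_cdf, sub_self] using
      (tendsto_cdf_atTop (gaussianReal 0 1)).const_sub 1
  have hbot : Tendsto gaussQ atBot (nhds 1) := by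
    simpa only [← gaussQ_eq_one_sub_cdf, sub_zero] using
      (tendsto_cdf_atBot (gaussianReal 0 1)).const_sub 1
  obtain ⟨a, ha⟩ := (htop.eventually_lt_const h0).exists
  obtain ⟨b, hb⟩ := (hbot.eventually_const_lt h1).exists
  exact Function.invFun_eq (mem_range_of_exists_le_of_exists_ge lipschitzWith_gaussQ.continuous
    ⟨a, ha.le⟩ ⟨b, hb.le⟩)

theorem mul_gaussQ_le_gaussianPDFReal {w : ℝ} (hw : 0 ≤ w) :
    w * gaussQ w ≤ gaussianPDFReal 0 1 w := by
  have hderiv : ∀ u ∈ Set.Ici w, HasDerivAt (fun u => -gaussianPDFReal 0 1 u)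
      (u * gaussianPDFReal 0 1 u) u := fun u _ => by
    simpa using (hasDerivAt_gaussianPDFReal u).fun_neg
  have hnonneg : ∀ u ∈ Set.Ioi w, 0 ≤ u * gaussianPDFReal 0 1 u := fun u hu =>
    mul_nonneg (hw.trans (le_of_lt hu)) (gaussianPDFReal_nonneg 0 1 u)
  have hlim : Tendsto (fun u => -gaussianPDFReal 0 1 u) atTop (nhds 0) := by
    simpa using tendsto_gaussianPDFReal_atTop.neg
  calc w * gaussQ w = ∫ u in Set.Ioi w, w * gaussianPDFReal 0 1 u := by
        rw [gaussQ_eq_integral, integral_const_mul]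
    _ ≤ ∫ u in Set.Ioi w, u * gaussianPDFReal 0 1 u :=
        setIntegral_mono_on ((integrable_gaussianPDFReal 0 1).integrableOn.const_mul w)
          (integrableOn_Ioi_deriv_of_nonneg' hderiv hnonneg hlim) measurableSet_Ioi
          fun u hu => mul_le_mul_of_nonneg_right (le_of_lt hu) (gaussianPDFReal_nonneg 0 1 u)
    _ = gaussianPDFReal 0 1 w := by
        rw [integral_Ioi_of_hasDerivAt_of_nonneg' hderiv hnonneg hlim, zero_sub, neg_neg]

/-- The Mills ratio of the standard Gaussian distribution. -/
def mills (w : ℝ) : ℝ := gaussQ w / gaussianPDFReal 0 1 w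

theorem mills_nonneg (w : ℝ) : 0 ≤ mills w :=
  div_nonneg (gaussQ_nonneg w) (gaussianPDFReal_nonneg 0 1 w)

theorem hasDerivAt_mills (w : ℝ) : HasDerivAt mills (w * mills w - 1) w := by
  have hpdf := (gaussianPDFReal_pos 0 1 w one_ne_zero).ne'
  convert! (hasDerivAt_gaussQ w).div (hasDerivAt_gaussianPDFReal w) hpdf using 1
  unfold mills
  field_simp
  ring

theorem continuous_mills : Continuous mills :=
  continuous_iff_continuousAt.2 fun w => (hasDerivAt_mills w).continuousAt

theorem mul_mills_le_one (w : ℝ) : w * mills w ≤ 1 := by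
  rcases le_total w 0 with hw | hw
  · exact (mul_nonpos_of_nonpos_of_nonneg hw (mills_nonneg w)).trans zero_le_one
  · rw [mills, ← mul_div_assoc, div_le_one (gaussianPDFReal_pos 0 1 w one_ne_zero)]
    exact mul_gaussQ_le_gaussianPDFReal hw

theorem antitone_mills : Antitone mills :=
  antitone_of_hasDerivAt_nonpos hasDerivAt_mills fun w => sub_nonpos.2 (mul_mills_le_one w)

theorem mills_le_two {w : ℝ} (hw : 0 ≤ w) : mills w ≤ 2 := by
  refine (antitone_mills hw).trans ?_
  have hzero : gaussQ 0 = 1 / 2 := by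
    have := gaussQ_neg 0
    rw [neg_zero] at this
    linarith
  have hsqrt : √(2 * Real.pi) ≤ 4 := Real.sqrt_le_iff.2 ⟨by norm_num, by linarith [Real.pi_le_four]⟩
  have hpdf : gaussianPDFReal 0 1 0 = (√(2 * Real.pi))⁻¹ := by simp [gaussianPDFReal_zero_one]
  rw [mills, hzero, hpdf, div_inv_eq_mul]
  linarith

end Gaussian

section SteinEquation

variable {x w δ : ℝ}

/-- The indicator function of `Set.Iio x`, centred by its standard Gaussian mean. -/
def centredIndicator (x w : ℝ) : ℝ := if w < x then gaussQ x else gaussQ x - 1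

/-- The bounded solution of the Stein equation `f' w = w * f w + h w` of the standard Gaussian
distribution, with `h` the function `centredIndicator x`. -/
def steinSol (x w : ℝ) : ℝ :=
  if w < x then gaussQ x * mills (-w) else gaussQ (-x) * mills w

theorem abs_centredIndicator_le (x w : ℝ) : |centredIndicator x w| ≤ 1 := by
  have h0 := gaussQ_nonneg x
  have h1 := gaussQ_le_one x
  unfold centredIndicator
  split_ifs <;> rw [abs_le] <;> constructor <;> linarith

theorem gaussQ_mul_mills_neg_le (h : w ≤ x) : gaussQ x * mills (-w) ≤ mills |w| := by
  rcases le_total w 0 with hw | hw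
  · rw [abs_of_nonpos hw]
    exact mul_le_of_le_one_left (mills_nonneg _) (gaussQ_le_one x)
  · rw [abs_of_nonneg hw, mills, mills, gaussianPDFReal_neg, ← mul_div_assoc]
    have hx : gaussQ x * gaussQ (-w) ≤ gaussQ w :=
      (mul_le_of_le_one_right (gaussQ_nonneg x) (gaussQ_le_one _)).trans
        (gaussQ_strictAnti.antitone h)
    exact div_le_div_of_nonneg_right hx (gaussianPDFReal_nonneg 0 1 w)

theorem steinSol_nonneg (x w : ℝ) : 0 ≤ steinSol x w := by
  unfold steinSol
  split_ifs <;> exact mul_nonneg (gaussQ_nonneg _) (mills_nonneg _)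

theorem steinSol_le_mills_abs (x w : ℝ) : steinSol x w ≤ mills |w| := by
  unfold steinSol
  split_ifs with h
  · exact gaussQ_mul_mills_neg_le h.le
  · simpa using gaussQ_mul_mills_neg_le (neg_le_neg (not_lt.1 h))

theorem abs_steinSol_le_two (x w : ℝ) : |steinSol x w| ≤ 2 := by
  rw [abs_of_nonneg (steinSol_nonneg x w)]
  exact (steinSol_le_mills_abs x w).trans (mills_le_two (abs_nonneg w))

theorem abs_mul_steinSol_le_one (x w : ℝ) : |w * steinSol x w| ≤ 1 := by
  rw [abs_mul, abs_of_nonneg (steinSol_nonneg x w)]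
  exact (mul_le_mul_of_nonneg_left (steinSol_le_mills_abs x w) (abs_nonneg w)).trans
    (mul_mills_le_one |w|)

theorem continuous_steinSol (x : ℝ) : Continuous (steinSol x) := by
  have hmills := continuous_mills
  have heq : steinSol x =
      fun w => if x ≤ w then gaussQ (-x) * mills w else gaussQ x * mills (-w) := by
    funext w
    simp only [steinSol, ← not_lt, ite_not]
  rw [heq]
  refine Continuous.if_le (by fun_prop) (by fun_prop) continuous_const continuous_id ?_
  rintro w rfl
  simp only [mills, gaussianPDFReal_neg]
  ring

/-- Because the indicator is that of an open half-line, the Stein equation also holds at its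
endpoint `x`, for the right derivative. -/
theorem hasDerivWithinAt_steinSol (x w : ℝ) :
    HasDerivWithinAt (steinSol x) (w * steinSol x w + centredIndicator x w) (Set.Ici w) w := by
  rcases lt_or_ge w x with h | h
  · have hderiv : HasDerivAt (fun u => gaussQ x * mills (-u))
        (gaussQ x * ((-w * mills (-w) - 1) * -1)) w :=
      ((hasDerivAt_mills (-w)).comp w (hasDerivAt_neg w)).const_mul _
    have heq : steinSol x =ᶠ[nhds w] fun u => gaussQ x * mills (-u) := by
      filter_upwards [eventually_lt_nhds h] with u hu using if_pos hu
    convert! (hderiv.congr_of_eventuallyEq heq).hasDerivWithinAt using 1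
    rw [steinSol, centredIndicator, if_pos h, if_pos h]
    ring
  · have hderiv := ((hasDerivAt_mills w).const_mul (gaussQ (-x))).hasDerivWithinAt (s := Set.Ici w)
    convert! hderiv.congr (fun u hu => if_neg (h.trans hu).not_gt) (if_neg h.not_gt) using 1
    rw [steinSol, centredIndicator, if_neg h.not_gt, if_neg h.not_gt, gaussQ_neg]
    ring

theorem abs_steinSol_add_sub_le (x w : ℝ) (hδ : 0 ≤ δ) :
    |steinSol x (w + δ) - steinSol x w| ≤ 2 * δ := by
  have hbound : ∀ u ∈ Set.Ico w (w + δ), ‖u * steinSol x u + centredIndicator x u‖ ≤ 2 :=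
    fun u _ => (norm_add_le _ _).trans <| by
      rw [Real.norm_eq_abs, Real.norm_eq_abs]
      linarith [abs_mul_steinSol_le_one x u, abs_centredIndicator_le x u]
  simpa using norm_image_sub_le_of_norm_deriv_right_le_segment
    (continuous_steinSol x).continuousOn (fun u _ => hasDerivWithinAt_steinSol x u) hbound
    (w + δ) (Set.right_mem_Icc.2 (le_add_of_nonneg_right hδ))

theorem abs_mul_steinSol_add_sub_le (x w : ℝ) (hδ : 0 ≤ δ) :
    |(w + δ) * steinSol x (w + δ) - w * steinSol x w| ≤ 2 * (1 + |w|) * δ := calc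
  |(w + δ) * steinSol x (w + δ) - w * steinSol x w|
      = |δ * steinSol x (w + δ) + w * (steinSol x (w + δ) - steinSol x w)| := by ring_nf
  _ ≤ δ * |steinSol x (w + δ)| + |w| * |steinSol x (w + δ) - steinSol x w| := by
    refine (abs_add_le _ _).trans_eq ?_
    rw [abs_mul, abs_mul, abs_of_nonneg hδ]
  _ ≤ δ * 2 + |w| * (2 * δ) := by
    gcongr
    · exact abs_steinSol_le_two x _
    · exact abs_steinSol_add_sub_le x w hδ
  _ = 2 * (1 + |w|) * δ := by ring

theorem centredIndicator_eq_of_notMem_Ioo {u : ℝ} (hx : x ∉ Set.Ioo w (w + δ))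
    (hu : u ∈ Set.Ico w (w + δ)) : centredIndicator x u = centredIndicator x w := by
  unfold centredIndicator
  grind

theorem abs_steinSol_taylor_le (hδ : 0 ≤ δ) (hx : x ∉ Set.Ioo w (w + δ)) :
    |steinSol x (w + δ) - steinSol x w - δ * (w * steinSol x w + centredIndicator x w)| ≤
      2 * (1 + |w|) * δ ^ 2 := by
  set c := w * steinSol x w + centredIndicator x w with hc
  have hcont : ContinuousOn (fun u => steinSol x u - u * c) (Set.Icc w (w + δ)) := by
    have := continuous_steinSol x
    fun_prop
  have hderiv : ∀ u ∈ Set.Ico w (w + δ), HasDerivWithinAt (fun u => steinSol x u - u * c)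
      (u * steinSol x u + centredIndicator x u - 1 * c) (Set.Ici u) u := fun u _ =>
    (hasDerivWithinAt_steinSol x u).sub ((hasDerivWithinAt_id u _).mul_const c)
  have hbound : ∀ u ∈ Set.Ico w (w + δ),
      ‖u * steinSol x u + centredIndicator x u - 1 * c‖ ≤ 2 * (1 + |w|) * δ := by
    intro u hu
    have hlip := abs_mul_steinSol_add_sub_le x w (sub_nonneg.2 hu.1)
    rw [add_sub_cancel] at hlip
    rw [hc, centredIndicator_eq_of_notMem_Ioo hx hu, one_mul, add_sub_add_right_eq_sub]
    exact hlip.trans (by gcongr; linarith [hu.2])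
  have hmain := norm_image_sub_le_of_norm_deriv_right_le_segment hcont hderiv hbound
    (w + δ) (Set.right_mem_Icc.2 (le_add_of_nonneg_right hδ))
  rw [Real.norm_eq_abs] at hmain
  convert! hmain using 1
  · congr 1
    ring
  · ring

end SteinEquation

section BerryEsseen

variable {p : ℝ} {n : ℕ}

theorem binom_succ (p : ℝ) {k : ℕ} (hk : k ≤ n) :
    (1 - p) * (k + 1) * binom n (k + 1) p = p * (n - k) * binom n k p := by
  rcases hk.eq_or_lt with rfl | hlt
  · simp [binom]
  · have hchoose : (n.choose (k + 1) : ℝ) * (k + 1) = n.choose k * (n - k) := by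
      rw [← Nat.cast_sub hk]
      exact_mod_cast Nat.choose_succ_right_eq n k
    obtain ⟨j, rfl⟩ := Nat.exists_eq_add_of_lt hlt
    unfold binom
    rw [show k + j + 1 - (k + 1) = j by lia, show k + j + 1 - k = j + 1 by lia]
    linear_combination (1 - p) ^ (j + 1) * p ^ (k + 1) * hchoose

theorem sum_binom_mul_succ (p : ℝ) (n : ℕ) (g : ℕ → ℝ) :
    ∑ k ∈ Finset.range (n + 1), binom n k p * (p * (n - k) * g (k + 1)) =
      ∑ k ∈ Finset.range (n + 1), binom n k p * ((1 - p) * k * g k) := by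
  have hzero : binom n (n + 1) p = 0 := by simp [binom]
  have hshift := (Finset.sum_range_succ' (fun k => binom n k p * ((1 - p) * k * g k)) (n + 1)).symm
  rw [Finset.sum_range_succ _ (n + 1), hzero, zero_mul, add_zero, Nat.cast_zero, mul_zero, zero_mul,
    mul_zero, add_zero] at hshift
  rw [← hshift]
  refine Finset.sum_congr rfl fun k hk => ?_
  have hsucc := binom_succ p (Finset.mem_range_succ_iff.1 hk)
  push_cast
  linear_combination -g (k + 1) * hsucc

theorem sum_binom_sub_mean_mul (p : ℝ) (n : ℕ) (g : ℕ → ℝ) :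
    ∑ k ∈ Finset.range (n + 1), binom n k p * ((k - n * p) * g k) =
      ∑ k ∈ Finset.range (n + 1), binom n k p * (p * (n - k) * (g (k + 1) - g k)) := by
  simp only [mul_sub (p * ((n : ℝ) - _)), mul_sub (binom n _ p), Finset.sum_sub_distrib]
  rw [sum_binom_mul_succ, ← Finset.sum_sub_distrib]
  exact Finset.sum_congr rfl fun k _ => by ring

/-- The standard deviation of the binomial distribution of parameters `n` and `p`. -/
def stdDev (p : ℝ) (n : ℕ) : ℝ := √(n * (p * (1 - p)))

/-- The standardization of `k`, a value of a binomial variable of parameters `n` and `p`. -/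
def zScore (p : ℝ) (n : ℕ) (k : ℝ) : ℝ := (k - n * p) / stdDev p n

theorem stdDev_pos (hp0 : 0 < p) (hp1 : p < 1) (hn : n ≠ 0) : 0 < stdDev p n := by
  have : 0 < 1 - p := sub_pos.2 hp1
  exact Real.sqrt_pos.2 (by positivity)

theorem stdDev_sq (hp0 : 0 ≤ p) (hp1 : p ≤ 1) (n : ℕ) : stdDev p n ^ 2 = n * (p * (1 - p)) := by
  have : 0 ≤ 1 - p := sub_nonneg.2 hp1
  exact Real.sq_sqrt (by positivity)

theorem zScore_add_one (p : ℝ) (n : ℕ) (k : ℝ) :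
    zScore p n (k + 1) = zScore p n k + 1 / stdDev p n := by
  unfold zScore
  ring

theorem stdDev_mul_zScore (hσ : stdDev p n ≠ 0) (k : ℝ) :
    stdDev p n * zScore p n k = k - n * p :=
  mul_div_cancel₀ _ hσ

theorem sum_binom_zScore_sq (hp0 : 0 < p) (hp1 : p < 1) (hn : n ≠ 0) :
    ∑ k ∈ Finset.range (n + 1), binom n k p * zScore p n k ^ 2 = 1 := by
  have hvar := (stdDev_pos hp0 hp1 hn).ne'
  simp only [zScore, div_pow, ← mul_div_assoc, ← Finset.sum_div]
  rw [sum_binom_variance, ← stdDev_sq hp0.le hp1.le, div_self (pow_ne_zero 2 hvar)]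

theorem sum_binom_abs_zScore_le_one (hp0 : 0 < p) (hp1 : p < 1) (hn : n ≠ 0) :
    ∑ k ∈ Finset.range (n + 1), binom n k p * |zScore p n k| ≤ 1 := calc
  ∑ k ∈ Finset.range (n + 1), binom n k p * |zScore p n k|
      ≤ ∑ k ∈ Finset.range (n + 1), (binom n k p + binom n k p * zScore p n k ^ 2) / 2 := by
    refine Finset.sum_le_sum fun k _ => ?_
    have hsq : |zScore p n k| ≤ (1 + zScore p n k ^ 2) / 2 := by
      nlinarith [sq_nonneg (|zScore p n k| - 1), sq_abs (zScore p n k)]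
    linarith [mul_le_mul_of_nonneg_left hsq (binom_nonneg hp0.le hp1.le n k)]
  _ = 1 := by
    rw [← Finset.sum_div, Finset.sum_add_distrib, sum_binom, sum_binom_zScore_sq hp0 hp1 hn]
    norm_num

theorem sum_binom_zScore_mul (hp0 : 0 < p) (hp1 : p < 1) (hn : n ≠ 0) (f : ℝ → ℝ) :
    ∑ k ∈ Finset.range (n + 1), binom n k p * (zScore p n k * f (zScore p n k)) =
      ∑ k ∈ Finset.range (n + 1), binom n k p * ((stdDev p n - p * zScore p n k) *
        (f (zScore p n k + 1 / stdDev p n) - f (zScore p n k))) := by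
  have hσ := (stdDev_pos hp0 hp1 hn).ne'
  refine mul_left_cancel₀ hσ ?_
  have hstein := sum_binom_sub_mean_mul p n fun k => f (zScore p n k)
  simp only [Nat.cast_succ, zScore_add_one] at hstein
  rw [Finset.mul_sum, Finset.mul_sum]
  convert! hstein using 2 with k _ k _
  · rw [← stdDev_mul_zScore hσ]
    ring
  · have hvar := stdDev_sq hp0.le hp1.le n
    have hz := stdDev_mul_zScore hσ (k : ℝ)
    linear_combination (binom n k p * (f (zScore p n k + 1 / stdDev p n) - f (zScore p n k))) *
      (hvar - p * hz)

theorem sum_binom_centredIndicator (hp0 : 0 < p) (hp1 : p < 1) (hn : n ≠ 0) (m : ℕ) :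
    ∑ k ∈ Finset.range (n + 1), binom n k p * centredIndicator (zScore p n m) (zScore p n k) =
      gaussQ (zScore p n m) - binomTail p n m := by
  have hσ := stdDev_pos hp0 hp1 hn
  have hlt (k : ℕ) : zScore p n k < zScore p n m ↔ k < m := by
    rw [zScore, zScore, div_lt_div_iff_of_pos_right hσ, sub_lt_sub_iff_right, Nat.cast_lt]
  have hind (k : ℕ) : binom n k p * centredIndicator (zScore p n m) (zScore p n k) =
      gaussQ (zScore p n m) * binom n k p - if m ≤ k then binom n k p else 0 := by
    simp only [centredIndicator, hlt, ← not_le]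
    split_ifs <;> ring
  simp only [hind, Finset.sum_sub_distrib, ← Finset.mul_sum, sum_binom, mul_one,
    ← Finset.sum_filter]
  rw [binomTail]
  congr 2
  grind

theorem zScore_notMem_Ioo (hσ : 0 < stdDev p n) (m k : ℕ) :
    zScore p n m ∉ Set.Ioo (zScore p n k) (zScore p n k + 1 / stdDev p n) := by
  rintro ⟨hlow, hup⟩
  rw [← zScore_add_one, zScore, zScore, div_lt_div_iff_of_pos_right hσ] at hup
  rw [zScore, zScore, div_lt_div_iff_of_pos_right hσ] at hlow
  have hkm : k < m := by exact_mod_cast (sub_lt_sub_iff_right _).1 hlow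
  have hmk : m < k + 1 := by exact_mod_cast (sub_lt_sub_iff_right _).1 hup
  lia

theorem abs_stein_remainder_le {x w σ : ℝ} (hp0 : 0 ≤ p) (hp1 : p ≤ 1) (hσ : 0 < σ)
    (hx : x ∉ Set.Ioo w (w + 1 / σ)) :
    |centredIndicator x w + w * steinSol x w -
        (σ - p * w) * (steinSol x (w + 1 / σ) - steinSol x w)| ≤ (2 + 4 * |w|) / σ := by
  have hδ : 0 ≤ 1 / σ := by positivity
  have htaylor := abs_steinSol_taylor_le hδ hx
  have hlip := abs_steinSol_add_sub_le x w hδ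
  set Δ := steinSol x (w + 1 / σ) - steinSol x w
  set c := w * steinSol x w + centredIndicator x w with hc
  calc |centredIndicator x w + w * steinSol x w - (σ - p * w) * Δ|
      = |p * w * Δ - σ * (Δ - 1 / σ * c)| := by
        rw [hc]; congr 1; field_simp; ring
    _ ≤ |p * w * Δ| + |σ * (Δ - 1 / σ * c)| := abs_sub _ _
    _ = p * |w| * |Δ| + σ * |Δ - 1 / σ * c| := by
        rw [abs_mul, abs_mul, abs_mul, abs_of_nonneg hp0, abs_of_pos hσ]
    _ ≤ 1 * |w| * (2 * (1 / σ)) + σ * (2 * (1 + |w|) * (1 / σ) ^ 2) := by gcongr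
    _ = (2 + 4 * |w|) / σ := by field_simp; ring

/-- The point `zScore p n m` at which the two tails are compared lies on the lattice, which is why
no bound on the probability of an atom is needed. -/
theorem abs_binomTail_sub_gaussQ_le (hp0 : 0 < p) (hp1 : p < 1) (hn : n ≠ 0) (m : ℕ) :
    |binomTail p n m - gaussQ (zScore p n m)| ≤ 6 / stdDev p n := by
  have hσ := stdDev_pos hp0 hp1 hn
  set x := zScore p n m with hx
  have hzero := sum_binom_zScore_mul hp0 hp1 hn (steinSol x)
  rw [abs_sub_comm, ← sum_binom_centredIndicator hp0 hp1 hn m, ← hx]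
  calc |∑ k ∈ Finset.range (n + 1), binom n k p * centredIndicator x (zScore p n k)|
      = |∑ k ∈ Finset.range (n + 1), binom n k p * (centredIndicator x (zScore p n k) +
          zScore p n k * steinSol x (zScore p n k) - (stdDev p n - p * zScore p n k) *
            (steinSol x (zScore p n k + 1 / stdDev p n) - steinSol x (zScore p n k)))| := by
        simp only [mul_sub (binom n _ p), mul_add (binom n _ p), Finset.sum_sub_distrib,
          Finset.sum_add_distrib] at hzero ⊢
        rw [hzero, add_sub_cancel_right]
    _ ≤ ∑ k ∈ Finset.range (n + 1), binom n k p * ((2 + 4 * |zScore p n k|) / stdDev p n) := by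
        refine (Finset.abs_sum_le_sum_abs _ _).trans (Finset.sum_le_sum fun k _ => ?_)
        have hb := binom_nonneg hp0.le hp1.le n k
        rw [abs_mul, abs_of_nonneg hb]
        exact mul_le_mul_of_nonneg_left
          (abs_stein_remainder_le hp0.le hp1.le hσ (zScore_notMem_Ioo hσ m k)) hb
    _ = (2 * ∑ k ∈ Finset.range (n + 1), binom n k p +
          4 * ∑ k ∈ Finset.range (n + 1), binom n k p * |zScore p n k|) / stdDev p n := by
        rw [Finset.mul_sum, Finset.mul_sum, ← Finset.sum_add_distrib, Finset.sum_div]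
        exact Finset.sum_congr rfl fun k _ => by ring
    _ ≤ (2 * 1 + 4 * 1) / stdDev p n := by
        rw [sum_binom]
        gcongr
        exact sum_binom_abs_zScore_le_one hp0 hp1 hn
    _ = 6 / stdDev p n := by norm_num

end BerryEsseen

section Quantile

theorem isBigO_sub_of_strictAnti {ι : Type*} {l : Filter ι} {f : ℝ → ℝ} {f' x : ℝ}
    (hanti : StrictAnti f) (hf : HasDerivAt f f' x) (hf' : f' ≠ 0) {z g : ι → ℝ}
    (hg : Tendsto g l (nhds 0)) (h : (fun i => f (z i) - f x) =O[l] g) :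
    (fun i => z i - x) =O[l] g := by
  have hfz : Tendsto (fun i => f (z i)) l (nhds (f x)) :=
    tendsto_sub_nhds_zero_iff.1 (h.trans_tendsto hg)
  have hz : Tendsto z l (nhds x) := tendsto_order.2
    ⟨fun a ha => (hfz.eventually_lt_const (hanti ha)).mono fun _ => hanti.lt_iff_gt.1,
      fun a ha => (hfz.eventually_const_lt (hanti ha)).mono fun _ => hanti.lt_iff_gt.1⟩
  exact ((hf.isTheta_sub hf').isBigO_symm.comp_tendsto (hz.prodMk tendsto_const_pure)).trans h

variable {p : ℝ}

theorem tendsto_one_div_stdDev (hp0 : 0 < p) (hp1 : p < 1) :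
    Tendsto (fun n => 1 / stdDev p n) atTop (nhds 0) := by
  have hvar : 0 < p * (1 - p) := mul_pos hp0 (sub_pos.2 hp1)
  exact (Real.tendsto_sqrt_atTop.comp
    (tendsto_natCast_atTop_atTop.atTop_mul_const hvar)).const_div_atTop 1

theorem abs_gaussQ_zScore_sub_le (hp0 : 0 < p) (hp1 : p < 1) {Pe : ℝ} (hPe1 : Pe < 1) {n : ℕ}
    (hn : n ≠ 0) {d : ℕ} (hd : IsLeast {k : ℕ | binomMD p n k ≤ Pe} d) :
    |gaussQ (zScore p n d) - Pe| ≤ 7 / stdDev p n := by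
  have hσ := stdDev_pos hp0 hp1 hn
  have hlt := lt_binomTail_of_isLeast hPe1 hd
  have hle : binomTail p n (d + 1) ≤ Pe := (binomTail_succ p n d).trans_le hd.1
  have hbe := abs_le.1 (abs_binomTail_sub_gaussQ_le hp0 hp1 hn d)
  have hbe_succ := abs_le.1 (abs_binomTail_sub_gaussQ_le hp0 hp1 hn (d + 1))
  have hlip := lipschitzWith_gaussQ.dist_le_mul (zScore p n (d + 1)) (zScore p n d)
  rw [Real.dist_eq, Real.dist_eq, zScore_add_one, add_sub_cancel_left, NNReal.coe_one, one_mul,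
    abs_of_pos (one_div_pos.2 hσ), ← zScore_add_one, abs_le] at hlip
  push_cast at hbe_succ
  have h7 : 7 / stdDev p n = 6 / stdDev p n + 1 / stdDev p n := by ring
  have hδ : 0 < 1 / stdDev p n := one_div_pos.2 hσ
  rw [abs_le, h7]
  constructor <;> linarith

theorem isBigO_zScore_sub_gaussQInv (hp0 : 0 < p) (hp1 : p < 1) {Pe : ℝ} (hPe0 : 0 < Pe)
    (hPe1 : Pe < 1) {d : ℕ → ℕ} (hd : ∀ n, IsLeast {k : ℕ | binomMD p n k ≤ Pe} (d n)) :
    (fun n => zScore p n (d n) - gaussQInv Pe) =O[atTop] fun n => 1 / stdDev p n := by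
  refine isBigO_sub_of_strictAnti gaussQ_strictAnti (hasDerivAt_gaussQ _)
    (neg_ne_zero.2 (gaussianPDFReal_pos 0 1 _ one_ne_zero).ne') (tendsto_one_div_stdDev hp0 hp1) ?_
  refine IsBigO.of_bound 7 ?_
  filter_upwards [eventually_ne_atTop 0] with n hn
  rw [gaussQ_gaussQInv hPe0 hPe1, Real.norm_eq_abs,
    Real.norm_of_nonneg (one_div_pos.2 (stdDev_pos hp0 hp1 hn)).le, mul_one_div]
  exact abs_gaussQ_zScore_sub_le hp0 hp1 hPe1 hn (hd n)

end Quantile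

section LocalLimit

/-- The error in Stirling's approximation of `log n!`, without the constant `log (2 * π) / 2`, so
that it vanishes at `n = 0`. -/
def stirlingError (n : ℕ) : ℝ := Real.log n.factorial - (n * Real.log n - n + Real.log n / 2)

theorem stirlingError_nonneg (n : ℕ) : 0 ≤ stirlingError n := by
  rcases eq_or_ne n 0 with rfl | hn
  · simp [stirlingError]
  · have hpi : 0 ≤ Real.log (2 * Real.pi) := Real.log_nonneg (by linarith [Real.pi_gt_three])
    unfold stirlingError
    linarith [Stirling.le_log_factorial_stirling hn]

theorem stirlingError_le_one (n : ℕ) : stirlingError n ≤ 1 := by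
  rcases n with _ | n
  · simp [stirlingError]
  · have hanti := Stirling.log_stirlingSeq'_antitone (Nat.zero_le n)
    have hformula := Stirling.log_stirlingSeq_formula (n + 1)
    have hn : ((n + 1 : ℕ) : ℝ) ≠ 0 := Nat.cast_ne_zero.2 n.succ_ne_zero
    simp only [Function.comp, Nat.succ_eq_add_one, zero_add] at hanti
    rw [Stirling.stirlingSeq_one, Real.log_div (Real.exp_pos _).ne' (by positivity), Real.log_exp,
      Real.log_sqrt zero_le_two] at hanti
    rw [Real.log_mul two_ne_zero hn, Real.log_div hn (Real.exp_pos _).ne', Real.log_exp] at hformula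
    unfold stirlingError
    linarith

theorem isBigO_stirlingError {ι : Type*} (l : Filter ι) (k : ι → ℕ) :
    (fun i => stirlingError (k i)) =O[l] fun _ => (1 : ℝ) :=
  .of_bound 1 <| .of_forall fun i => by
    rw [Real.norm_of_nonneg (stirlingError_nonneg _), norm_one, mul_one]
    exact stirlingError_le_one _

theorem sub_le_mul_log_sub_log {a b : ℝ} (ha : 0 < a) (hb : 0 < b) :
    a - b ≤ a * (Real.log a - Real.log b) := by
  have hlog := mul_le_mul_of_nonneg_left (Real.log_le_sub_one_of_pos (div_pos hb ha)) ha.le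
  rw [Real.log_div hb.ne' ha.ne', mul_sub a (b / a), mul_div_cancel₀ _ ha.ne'] at hlog
  linarith

theorem mul_log_sub_log_le {a b : ℝ} (ha : 0 < a) (hb : 0 < b) :
    a * (Real.log a - Real.log b) ≤ a - b + (a - b) ^ 2 / b := calc
  a * (Real.log a - Real.log b) = a * Real.log (a / b) := by rw [Real.log_div ha.ne' hb.ne']
  _ ≤ a * (a / b - 1) :=
    mul_le_mul_of_nonneg_left (Real.log_le_sub_one_of_pos (div_pos ha hb)) ha.le
  _ = a - b + (a - b) ^ 2 / b := by field_simp; ring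

variable {p : ℝ}

/-- The Kullback-Leibler divergence of `n` independent Bernoulli variables of parameter `k / n` from
`n` independent Bernoulli variables of parameter `p`. -/
def bernoulliDivergence (p : ℝ) (n k : ℕ) : ℝ :=
  k * (Real.log k - Real.log (n * p)) + (n - k) * (Real.log (n - k) - Real.log (n * (1 - p)))

section divergence

variable {n k : ℕ} (hp0 : 0 < p) (hp1 : p < 1) (hk : 0 < k) (hkn : k < n)

include hp0 hp1 hk hkn

theorem bernoulliDivergence_nonneg : 0 ≤ bernoulliDivergence p n k := by
  have hn : (0 : ℝ) < n := by exact_mod_cast hk.trans hkn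
  have hm : (0 : ℝ) < n - k := sub_pos.2 (by exact_mod_cast hkn)
  have hleft := sub_le_mul_log_sub_log (Nat.cast_pos.2 hk) (mul_pos hn hp0)
  have hright := sub_le_mul_log_sub_log hm (mul_pos hn (sub_pos.2 hp1))
  unfold bernoulliDivergence
  linarith

theorem bernoulliDivergence_le_zScore_sq : bernoulliDivergence p n k ≤ zScore p n k ^ 2 := by
  have hn : (0 : ℝ) < n := by exact_mod_cast hk.trans hkn
  have hm : (0 : ℝ) < n - k := sub_pos.2 (by exact_mod_cast hkn)
  have hq : 0 < 1 - p := sub_pos.2 hp1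
  calc bernoulliDivergence p n k
      ≤ k - n * p + (k - n * p) ^ 2 / (n * p) +
          (n - k - n * (1 - p) + (n - k - n * (1 - p)) ^ 2 / (n * (1 - p))) :=
        add_le_add (mul_log_sub_log_le (Nat.cast_pos.2 hk) (mul_pos hn hp0))
          (mul_log_sub_log_le hm (mul_pos hn hq))
    _ = (k - n * p) ^ 2 / (n * (p * (1 - p))) := by field_simp; ring
    _ = zScore p n k ^ 2 := by rw [zScore, div_pow, stdDev_sq hp0.le hp1.le]

end divergence

theorem log_binom (hp0 : 0 < p) (hp1 : p < 1) {n k : ℕ} (hk : k ≤ n) :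
    Real.log (binom n k p) =
      Real.log (n.choose k) + (n - k) * Real.log (1 - p) + k * Real.log p := by
  have : 0 < 1 - p := sub_pos.2 hp1
  have hc : (0 : ℝ) < n.choose k := by exact_mod_cast Nat.choose_pos hk
  rw [binom, Real.log_mul (by positivity) (by positivity), Real.log_mul hc.ne' (by positivity),
    Real.log_pow, Real.log_pow, Nat.cast_sub hk]

theorem log_choose {n k : ℕ} (hk : k ≤ n) :
    Real.log (n.choose k) =
      Real.log n.factorial - Real.log k.factorial - Real.log (n - k).factorial := by
  have hpos (j : ℕ) : (j.factorial : ℝ) ≠ 0 := Nat.cast_ne_zero.2 j.factorial_ne_zero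
  rw [Nat.cast_choose ℝ hk, Real.log_div (hpos n) (mul_ne_zero (hpos k) (hpos _)),
    Real.log_mul (hpos k) (hpos _)]
  ring

theorem log_binom_add_half_log (hp0 : 0 < p) (hp1 : p < 1) {n k : ℕ} (hk : 0 < k) (hkn : k < n) :
    Real.log (binom n k p) + Real.log n / 2 =
      stirlingError n - stirlingError k - stirlingError (n - k) - bernoulliDivergence p n k -
        Real.log (k / n) / 2 - Real.log (1 - k / n) / 2 := by
  have hq : 1 - p ≠ 0 := (sub_pos.2 hp1).ne'
  have hk' : (k : ℝ) ≠ 0 := by exact_mod_cast hk.ne'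
  have hn : (n : ℝ) ≠ 0 := by exact_mod_cast (hk.trans hkn).ne'
  have hm : (n : ℝ) - k ≠ 0 := (sub_pos.2 (by exact_mod_cast hkn)).ne'
  rw [log_binom hp0 hp1 hkn.le, log_choose hkn.le, one_sub_div hn, Real.log_div hk' hn,
    Real.log_div hm hn, bernoulliDivergence, Real.log_mul hn hp0.ne', Real.log_mul hn hq]
  simp only [stirlingError, Nat.cast_sub hkn.le]
  ring

section sequence

variable (hp0 : 0 < p) (hp1 : p < 1) {k : ℕ → ℕ}

include hp0 hp1

theorem tendsto_div_of_isBigO_zScore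
    (hz : (fun n => zScore p n (k n)) =O[atTop] fun _ => (1 : ℝ)) :
    Tendsto (fun n => (k n : ℝ) / n) atTop (nhds p) := by
  have hlim : Tendsto (fun n => zScore p n (k n) * (1 / stdDev p n) * (p * (1 - p))) atTop
      (nhds 0) := by
    have hone := hz.mul (isBigO_refl (fun n => 1 / stdDev p n) atTop)
    simp only [one_mul] at hone
    simpa using (hone.trans_tendsto (tendsto_one_div_stdDev hp0 hp1)).mul_const (p * (1 - p))
  refine (zero_add p ▸ hlim.add_const p).congr' ?_
  filter_upwards [eventually_ne_atTop 0] with n hn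
  have hσ := (stdDev_pos hp0 hp1 hn).ne'
  have hn' : (n : ℝ) ≠ 0 := Nat.cast_ne_zero.2 hn
  have hsq := stdDev_sq hp0.le hp1.le n
  rw [zScore]
  field_simp
  linear_combination (n * p - k n) * hsq

theorem isBigO_log_binom_add_half_log
    (hz : (fun n => zScore p n (k n)) =O[atTop] fun _ => (1 : ℝ)) :
    (fun n => Real.log (binom n (k n) p) + Real.log n / 2) =O[atTop] fun _ => (1 : ℝ) := by
  have hlim := tendsto_div_of_isBigO_zScore hp0 hp1 hz
  have hmem : ∀ᶠ n : ℕ in atTop, 0 < k n ∧ k n < n := by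
    filter_upwards [hlim.eventually_const_lt hp0, hlim.eventually_lt_const hp1,
      eventually_gt_atTop 0] with n h0 h1 hn
    have hn' : (0 : ℝ) < n := Nat.cast_pos.2 hn
    exact ⟨by exact_mod_cast (div_pos_iff_of_pos_right hn').1 h0,
      by exact_mod_cast (div_lt_one hn').1 h1⟩
  have hdiv : (fun n => bernoulliDivergence p n (k n)) =O[atTop] fun _ => (1 : ℝ) := by
    have hz_sq : (fun n => zScore p n (k n) ^ 2) =O[atTop] fun _ => (1 : ℝ) := by
      simpa only [one_pow] using hz.pow 2
    refine IsBigO.trans (.of_norm_eventuallyLE ?_) hz_sq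
    filter_upwards [hmem] with n hn
    rw [Real.norm_of_nonneg (bernoulliDivergence_nonneg hp0 hp1 hn.1 hn.2)]
    exact bernoulliDivergence_le_zScore_sq hp0 hp1 hn.1 hn.2
  have hlog : (fun n => Real.log (k n / n) / 2) =O[atTop] fun _ => (1 : ℝ) :=
    ((hlim.log hp0.ne').div_const 2).isBigO_one ℝ
  have hlog' : (fun n => Real.log (1 - k n / n) / 2) =O[atTop] fun _ => (1 : ℝ) :=
    (((hlim.const_sub 1).log (sub_pos.2 hp1).ne').div_const 2).isBigO_one ℝ
  refine (((((isBigO_stirlingError atTop fun n => n).sub (isBigO_stirlingError atTop k)).sub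
    (isBigO_stirlingError atTop fun n => n - k n)).sub hdiv).sub hlog |>.sub hlog').congr' ?_ .rfl
  filter_upwards [hmem] with n hn
  exact (log_binom_add_half_log hp0 hp1 hn.1 hn.2).symm

end sequence

end LocalLimit

section LowerTail

variable {n d : ℕ}

theorem binomFA_zero (n : ℕ) : binomFA n 0 = binom n 0 (1 / 2) := by
  rw [binomFA, Finset.Icc_self, Finset.sum_singleton]

theorem binomFA_succ (n d : ℕ) : binomFA n (d + 1) = binomFA n d + binom n (d + 1) (1 / 2) :=
  Finset.sum_Icc_succ_top (Nat.zero_le _) _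

theorem binom_half_eq (hd : d < n) :
    binom n d (1 / 2) = (d + 1) / (n - d) * binom n (d + 1) (1 / 2) := by
  have hsub : (n : ℝ) - d ≠ 0 := (sub_pos.2 (Nat.cast_lt.2 hd)).ne'
  have hsucc := binom_succ (1 / 2) hd.le
  field_simp
  linear_combination -2 * hsucc

theorem binomFA_le (hd : 2 * d < n) :
    binomFA n d ≤ (n - d) / (n - 2 * d) * binom n d (1 / 2) := by
  induction d with
  | zero =>
    have hn : (n : ℝ) ≠ 0 := Nat.cast_ne_zero.2 (by lia)
    simp [binomFA_zero, hn]
  | succ d ih =>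
    have hgap : (2 * (d + 1) : ℝ) < n := by exact_mod_cast hd
    have : (0 : ℝ) ≤ d := d.cast_nonneg
    have hsub : (0 : ℝ) < n - d := by linarith
    have hgap₀ : (0 : ℝ) < n - 2 * d := by linarith
    have hgap₁ : (0 : ℝ) < n - 2 * (d + 1) := by linarith
    calc binomFA n (d + 1)
        ≤ (n - d) / (n - 2 * d) * binom n d (1 / 2) + binom n (d + 1) (1 / 2) :=
          (binomFA_succ n d).trans_le (add_le_add_left (ih (by lia)) _)
      _ = (n - d + 1) / (n - 2 * d) * binom n (d + 1) (1 / 2) := by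
          rw [binom_half_eq (by lia), ← mul_assoc, div_mul_div_cancel₀' hsub.ne',
            ← add_one_mul, div_add_one hgap₀.ne']
          ring
      _ ≤ (n - (d + 1)) / (n - 2 * (d + 1)) * binom n (d + 1) (1 / 2) := by
          refine mul_le_mul_of_nonneg_right ?_ (binom_nonneg (by norm_num) (by norm_num) _ _)
          rw [div_le_div_iff₀ hgap₀ hgap₁]
          linarith
      _ = _ := by push_cast; rfl

theorem div_mul_binom_half_le (hd : d ≤ n) {ζ : ℝ} (hζ : ζ ≤ 1) :
    d / n * binom n d (1 / 2) ≤ binomFA n d - ζ * binom n d (1 / 2) := by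
  have hb (k : ℕ) : 0 ≤ binom n k (1 / 2) := binom_nonneg (by norm_num) (by norm_num) n k
  have hatom : ζ * binom n d (1 / 2) ≤ binom n d (1 / 2) := mul_le_of_le_one_left (hb d) hζ
  rcases d with _ | d
  · simpa [binomFA_zero] using hatom
  · have hsub : (0 : ℝ) < n - d := sub_pos.2 (Nat.cast_lt.2 hd)
    have hstep : ((d + 1 : ℕ) : ℝ) / n * binom n (d + 1) (1 / 2) ≤ binom n d (1 / 2) := by
      rw [binom_half_eq hd]
      refine mul_le_mul_of_nonneg_right ?_ (hb _)
      push_cast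
      exact div_le_div_of_nonneg_left (by positivity) hsub (sub_le_self _ d.cast_nonneg)
    have hlast : binom n d (1 / 2) ≤ binomFA n d :=
      Finset.single_le_sum (fun k _ => hb k) (Finset.mem_Icc.2 ⟨d.zero_le, le_rfl⟩)
    rw [binomFA_succ]
    linarith

theorem isBigO_of_le_of_le {ι : Type*} {l : Filter ι} {f lower upper g : ι → ℝ}
    (hlower : lower =O[l] g) (hupper : upper =O[l] g)
    (h : ∀ᶠ i in l, lower i ≤ f i ∧ f i ≤ upper i) : f =O[l] g := by
  refine IsBigO.trans (.of_norm_eventuallyLE ?_) (hlower.norm_left.add hupper.norm_left)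
  filter_upwards [h] with i hi
  exact (abs_le_max_abs_abs hi.1 hi.2).trans
    (max_le_add_of_nonneg (abs_nonneg _) (abs_nonneg _))

theorem isBigO_log_lowerTail_sub_log_binom {p : ℝ} (hp0 : 0 < p) (hp1 : p < 1 / 2) {d : ℕ → ℕ}
    {ζ : ℕ → ℝ} (hd : Tendsto (fun n => (d n : ℝ) / n) atTop (nhds p)) (hζ0 : ∀ n, 0 ≤ ζ n)
    (hζ1 : ∀ n, ζ n ≤ 1) :
    (fun n => Real.log (binomFA n (d n) - ζ n * binom n (d n) (1 / 2)) -
      Real.log (binom n (d n) (1 / 2))) =O[atTop] fun _ => (1 : ℝ) := by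
  have hp2 : 0 < 1 - 2 * p := by linarith
  have hlower := (hd.log hp0.ne').isBigO_one ℝ
  have hupper := (((hd.const_sub 1).div ((hd.const_mul 2).const_sub 1) hp2.ne').log
    (div_pos (by linarith) hp2).ne').isBigO_one ℝ
  refine isBigO_of_le_of_le hlower hupper ?_
  filter_upwards [hd.eventually_const_lt hp0, hd.eventually_lt_const hp1, eventually_gt_atTop 0]
    with n h0 h1 hn
  have hn' : (0 : ℝ) < n := Nat.cast_pos.2 hn
  have hlt : 2 * d n < n := by
    rw [div_lt_div_iff₀ hn' two_pos] at h1
    have : (d n : ℝ) * 2 < n := by linarith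
    exact_mod_cast (mul_comm _ _).trans_lt this
  have hb : 0 < binom n (d n) (1 / 2) := binom_pos (by norm_num) (by norm_num) (by lia)
  have hge := div_mul_binom_half_le (n := n) (d := d n) (by lia) (hζ1 n)
  have hle : binomFA n (d n) - ζ n * binom n (d n) (1 / 2) ≤
      (1 - d n / n) / (1 - 2 * (d n / n)) * binom n (d n) (1 / 2) := by
    have hratio : (1 - (d n : ℝ) / n) / (1 - 2 * (d n / n)) = (n - d n) / (n - 2 * d n) := by
      rw [← mul_div_assoc, one_sub_div hn'.ne', one_sub_div hn'.ne',
        div_div_div_cancel_right₀ hn'.ne']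
    rw [hratio]
    exact (sub_le_self _ (mul_nonneg (hζ0 n) hb.le)).trans (binomFA_le hlt)
  have hpos := (mul_pos h0 hb).trans_le hge
  rw [← Real.log_div hpos.ne' hb.ne']
  exact ⟨Real.log_le_log h0 ((le_div_iff₀ hb).2 hge),
    Real.log_le_log (div_pos hpos hb) ((div_le_iff₀ hb).2 hle)⟩

end LowerTail

section NormalApproximation

variable {p Pe : ℝ}

theorem log_binom_half (hp0 : 0 < p) (hp1 : p < 1) {n k : ℕ} (hk : k ≤ n) :
    Real.log (binom n k (1 / 2)) = Real.log (binom n k p) - n * Real.log 2 -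
      (n - k) * Real.log (1 - p) - k * Real.log p := by
  rw [log_binom hp0 hp1 hk, log_binom (by norm_num) (by norm_num) hk,
    show (1 - 1 / 2 : ℝ) = 2⁻¹ by norm_num, show (1 / 2 : ℝ) = 2⁻¹ by norm_num, Real.log_inv]
  ring

theorem sqrt_dispersion_div (hp0 : 0 < p) (hp1 : p ≤ 1 / 2) (n : ℕ) :
    √(dispersion p / n) = stdDev p n * (Real.log (1 - p) - Real.log p) / n := by
  have hq : 0 < 1 - p := by linarith
  have hlog : 0 ≤ Real.log (1 - p) - Real.log p :=
    sub_nonneg.2 (Real.log_le_log hp0 (by linarith))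
  have hσ : 0 ≤ stdDev p n := Real.sqrt_nonneg _
  have hsq : dispersion p / n = (stdDev p n * (Real.log (1 - p) - Real.log p) / n) ^ 2 := by
    rw [div_pow, mul_pow, stdDev_sq hp0.le (by linarith), dispersion,
      Real.log_div hq.ne' hp0.ne']
    rcases eq_or_ne n 0 with rfl | hn
    · simp
    · field_simp
  rw [hsq, Real.sqrt_sq (div_nonneg (mul_nonneg hσ hlog) n.cast_nonneg)]

theorem mul_normalApprox (hp0 : 0 < p) (hp1 : p ≤ 1 / 2) {n : ℕ} (hn : n ≠ 0) :
    n * Real.log 2 * normalApprox (capacity p) (dispersion p) Pe n =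
      n * (Real.log 2 + p * Real.log p + (1 - p) * Real.log (1 - p)) -
        stdDev p n * gaussQInv Pe * (Real.log (1 - p) - Real.log p) + Real.log n / 2 := by
  rw [normalApprox, sqrt_dispersion_div hp0 hp1, capacity, entropy]
  simp only [Real.logb, Real.log_exp]
  field_simp
  ring

theorem log_binom_half_add_mul_normalApprox (hp0 : 0 < p) (hp1 : p ≤ 1 / 2) {n k : ℕ}
    (hn : n ≠ 0) (hk : k ≤ n) :
    Real.log (binom n k (1 / 2)) +
        n * Real.log 2 * normalApprox (capacity p) (dispersion p) Pe n =
      Real.log (binom n k p) + Real.log n / 2 +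
        stdDev p n * (zScore p n k - gaussQInv Pe) * (Real.log (1 - p) - Real.log p) := by
  have hp1' : p < 1 := by linarith
  rw [log_binom_half hp0 hp1' hk, mul_normalApprox hp0 hp1 hn, mul_sub (stdDev p n),
    stdDev_mul_zScore (stdDev_pos hp0 hp1' hn).ne']
  ring

theorem isBigO_log_binom_half_add_mul_normalApprox (hp0 : 0 < p) (hp1 : p ≤ 1 / 2) {k : ℕ → ℕ}
    (hk : ∀ n, k n ≤ n)
    (hz : (fun n => zScore p n (k n) - gaussQInv Pe) =O[atTop] fun n => 1 / stdDev p n)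
    (hz1 : (fun n => zScore p n (k n)) =O[atTop] fun _ => (1 : ℝ)) :
    (fun n => Real.log (binom n (k n) (1 / 2)) +
      n * Real.log 2 * normalApprox (capacity p) (dispersion p) Pe n) =O[atTop]
        fun _ => (1 : ℝ) := by
  have hp1' : p < 1 := by linarith
  have hshift : (fun n => stdDev p n * (zScore p n (k n) - gaussQInv Pe)) =O[atTop]
      fun _ => (1 : ℝ) := by
    refine ((isBigO_refl (stdDev p) atTop).mul hz).congr' .rfl ?_
    filter_upwards [eventually_ne_atTop 0] with n hn
    exact mul_one_div_cancel (stdDev_pos hp0 hp1' hn).ne'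
  have hscaled : (fun n => stdDev p n * (zScore p n (k n) - gaussQInv Pe) *
      (Real.log (1 - p) - Real.log p)) =O[atTop] fun _ => (1 : ℝ) := by
    simpa only [mul_comm] using hshift.const_mul_left (Real.log (1 - p) - Real.log p)
  refine ((isBigO_log_binom_add_half_log hp0 hp1' hz1).add hscaled).congr' ?_ .rfl
  filter_upwards [eventually_ne_atTop 0] with n hn
  exact (log_binom_half_add_mul_normalApprox hp0 hp1 hn (hk n)).symm

theorem isBigO_neg_logb_div_sub {T r : ℕ → ℝ}
    (h : (fun n => Real.log (T n) + n * Real.log 2 * r n) =O[atTop] fun _ => (1 : ℝ)) :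
    (fun n : ℕ => -(1 / (n : ℝ)) * Real.logb 2 (T n) - r n) =O[atTop]
      fun n : ℕ => 1 / (n : ℝ) := by
  have hdiv := ((isBigO_refl (fun n : ℕ => 1 / (n : ℝ)) atTop).mul h).const_mul_left
    (-(Real.log 2)⁻¹)
  refine hdiv.congr' ?_ (.of_forall fun _ => mul_one _)
  filter_upwards [eventually_ne_atTop 0] with n hn
  have hlog : Real.log 2 ≠ 0 := (Real.log_pos one_lt_two).ne'
  rw [Real.logb]
  field_simp
  ring

theorem isBigO_sub_normalApprox (hp0 : 0 < p) (hp1 : p < 1 / 2) (hPe0 : 0 < Pe) (hPe1 : Pe < 1)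
    {d : ℕ → ℕ} {ζ : ℕ → ℝ} (hd : ∀ n, IsLeast {k : ℕ | binomMD p n k ≤ Pe} (d n))
    (hdn : ∀ n, d n ≤ n) (hζ0 : ∀ n, 0 ≤ ζ n) (hζ1 : ∀ n, ζ n ≤ 1) :
    (fun n : ℕ => -(1 / (n : ℝ)) *
        Real.logb 2 (binomFA n (d n) - ζ n * binom n (d n) (1 / 2)) -
      normalApprox (capacity p) (dispersion p) Pe n) =O[atTop] fun n : ℕ => 1 / (n : ℝ) := by
  have hp1' : p < 1 := by linarith
  have hz := isBigO_zScore_sub_gaussQInv hp0 hp1' hPe0 hPe1 hd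
  have hz1 : (fun n => zScore p n (d n)) =O[atTop] fun _ => (1 : ℝ) := by
    have hlim := (hz.trans_tendsto (tendsto_one_div_stdDev hp0 hp1')).add_const (gaussQInv Pe)
    simpa only [sub_add_cancel] using hlim.isBigO_one ℝ
  have hlower := isBigO_log_lowerTail_sub_log_binom hp0 hp1
    (tendsto_div_of_isBigO_zScore hp0 hp1' hz1) hζ0 hζ1
  have hatom := isBigO_log_binom_half_add_mul_normalApprox hp0 hp1.le hdn hz hz1
  exact isBigO_neg_logb_div_sub <| (hlower.add hatom).congr_left fun n => by ring

end NormalApproximation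

end BSC

end

theorem mainTheorem4 (p Pe : ℝ) (hp0 : 0 < p) (hp1 : p < 1 / 2) (hPe0 : 0 < Pe) (hPe1 : Pe < 1) :
    ∃ Rbar : ℕ → ℝ,
      (∀ n : ℕ, 1 ≤ n → ∀ (a : BSC.Word n) (R : ℝ),
        BSC.IsMetaConverse p Pe a R ↔ R = Rbar n) ∧
      (∀ n : ℕ, 1 ≤ n → ∃ (d : ℕ) (ζ : ℝ),
        IsLeast {k : ℕ | BSC.binomMD p n k ≤ Pe} d ∧ d ≤ n ∧ 0 ≤ ζ ∧ ζ < 1 ∧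
        Pe = BSC.binomMD p n d + ζ * BSC.binom n d p ∧
        Rbar n = -(1 / (n : ℝ)) *
          Real.logb 2 (BSC.binomFA n d - ζ * BSC.binom n d (1 / 2))) ∧
      (fun n : ℕ => Rbar n - BSC.normalApprox (BSC.capacity p) (BSC.dispersion p) Pe n)
        =O[atTop] (fun n : ℕ => 1 / (n : ℝ)) := by
  have hp1' : p < 1 := by linarith
  choose d ζ hd hdn hζ0 hζ1 hPe using fun n => BSC.exists_threshold hp0 hp1' hPe0.le hPe1 n
  refine ⟨fun n => -(1 / (n : ℝ)) *
    Real.logb 2 (BSC.binomFA n (d n) - ζ n * BSC.binom n (d n) (1 / 2)), fun n hn a R => ?_,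
    fun n _ => ⟨d n, ζ n, hd n, hdn n, hζ0 n, hζ1 n, hPe n, rfl⟩,
    BSC.isBigO_sub_normalApprox hp0 hp1 hPe0 hPe1 hd hdn hζ0 fun n => (hζ1 n).le⟩
  have hbinom := BSC.isMetaConverse_of_binom hp0 hp1 (Nat.one_le_iff_ne_zero.1 hn) a (hdn n)
    (hζ0 n) (hζ1 n) (hPe n)
  exact ⟨fun hR => hR.unique hp0 hp1' hbinom, fun hR => hR ▸ hbinom⟩
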